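/- Let $X_1,X_2,\ldots$ be independent random variables, each Exponential with rate $1$. For $n\ge 1$ let $Y_n$ be the product of all $X_i$ with $1\le i\le n$ and $i\equiv n \pmod 2$, divided by the product of all $X_i$ with $1\le i\le n$ and $i\not\equiv n\pmod 2$, and let $Z_n=\ln Y_n$. Then almost surely $Z_n=\sum_{i=1}^{n}(-1)^{n-i}\ln X_i$, and the cumulative distribution function $F_{Z_n}$ of $Z_n$ is given, for every $z\in\mathbb{R}$, as follows. (i) $$F_{Z_n}(z)=\begin{cases} G^{1,1}_{1,2}\left(e^z\,\middle|\,\begin{matrix}1\\ 1,0\end{matrix}\right) & n=1,\\[2mm] G^{(n+1)/2,\,(n-1)/2}_{(n-1)/2,\,(n+1)/2}\left(e^z\,\middle|\,\begin{matrix}1,0,\ldots,0\\ 1,1,\ldots,1\end{matrix}\right) & n\in\{3,5,7,\ldots\},\\[2mm] G^{n/2,\,n/2}_{n/2,\,n/2}\left(e^z\,\middle|\,\begin{matrix}1,0,\ldots,0\\ 1,1,\ldots,1\end{matrix}\right) & n\in\{2,4,6,\ldots\}.\end{cases}$$ Here $G$ is the Meijer G-function $$G^{\mu,\nu}_{p,q}\left(x\,\middle|\,\begin{matrix}a_1,\ldots,a_p\\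 b_1,\ldots,b_q\end{matrix}\right)=\frac{1}{2\pi i}\int_{c-i\infty}^{c+i\infty}\frac{\prod_{k=1}^{\nu}\Gamma(1-a_k-s)\,\prod_{j=1}^{\mu}\Gamma(b_j+s)}{\prod_{k=\nu+1}^{p}\Gamma(a_k+s)\,\prod_{j=\mu+1}^{q}\Gamma(1-b_j-s)}\,x^{-s}\,ds ,$$ where the line $\operatorname{Re}s=c$ has all poles of the factors $\Gamma(b_j+s)$, $j\le\mu$, on its left and all poles of the factors $\Gamma(1-a_k-s)$, $k\le\nu$, on its right. For the parameters above such lines exist, and along each of them the integral converges absolutely, to the same value. (ii) Equivalently, $$F_{Z_n}(z)=\begin{cases}\displaystyle \frac12+\int_0^\infty\!\left(\int_0^\infty e^{-t}\,\frac{\sin\big((z-\ln t)\,\omega\big)}{\pi\omega}\left(\frac{\pi\omega}{\sinh(\pi\omega)}\right)^{(n-1)/2}dt\right)d\omega & n\in\{1,3,5,\ldots\},\\[4mm] \displaystyle \frac12+\int_0^\infty \frac{\sin(z\omega)}{\pi\omega}\left(\frac{\pi\omega}{\sinh(\pi\omega)}\right)^{n/2}d\omega & n\in\{2,4,6,\ldots\},\end{cases}$$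 where the double integral is an iterated integral; the inner integral (for each $\omega>0$), the outer integral and the single integral all converge absolutely. -/

import Mathlib

open MeasureTheory ProbabilityTheory Set

/-- The ratio `Y_n`: the product of the `X i` with `1 ≤ i ≤ n` and `i` of the same parity as `n`,
divided by the product of the `X i` with `1 ≤ i ≤ n` and `i` of the opposite parity. -/
noncomputable def ratioY {Ω : Type*} (X : ℕ → Ω → ℝ) (n : ℕ) (ω : Ω) : ℝ :=
  (∏ i ∈ (Finset.Icc 1 n).filter (fun i => i % 2 = n % 2), X i ω) /
    (∏ i ∈ (Finset.Icc 1 n).filter (fun i => i % 2 ≠ n % 2), X i ω)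

/-- The random variable `Z_n = ln Y_n`. -/
noncomputable def logRatioZ {Ω : Type*} (X : ℕ → Ω → ℝ) (n : ℕ) (ω : Ω) : ℝ :=
  Real.log (ratioY X n ω)

/-- The Mellin-Barnes integrand of the Meijer function `G^{m,n}_{p,q}(z | a ; b)`:
`∏_{k ≤ n} Γ(1 - a_k - s) ∏_{j ≤ m} Γ(b_j + s) /
  (∏_{k > n} Γ(a_k + s) ∏_{j > m} Γ(1 - b_j - s)) · z^{-s}`.
(`Complex.Gamma` takes the value `0` at its poles and `x / 0 = 0`, so that the denominator yields
the values of the entire function `1 / Γ` everywhere.) -/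
noncomputable def meijerIntegrand (m n : ℕ) {p q : ℕ} (a : Fin p → ℂ) (b : Fin q → ℂ)
    (z s : ℂ) : ℂ :=
  ((∏ k ∈ Finset.univ.filter (fun k : Fin p => k.val < n), Complex.Gamma (1 - a k - s)) *
      (∏ j ∈ Finset.univ.filter (fun j : Fin q => j.val < m), Complex.Gamma (b j + s))) /
    ((∏ k ∈ Finset.univ.filter (fun k : Fin p => n ≤ k.val), Complex.Gamma (a k + s)) *
      (∏ j ∈ Finset.univ.filter (fun j : Fin q => m ≤ j.val), Complex.Gamma (1 - b j - s))) *
    z ^ (-s)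

/-- The vertical line `Re s = c` separates the poles `s = - b_j - l` (`j ≤ m`, `l = 0, 1, …`) of the
factors `Γ(b_j + s)`, which lie to its left, from the poles `s = 1 - a_k + l` (`k ≤ n`,
`l = 0, 1, …`) of the factors `Γ(1 - a_k - s)`, which lie to its right. -/
def MeijerSeparates (m n : ℕ) {p q : ℕ} (a : Fin p → ℂ) (b : Fin q → ℂ) (c : ℝ) : Prop :=
  (∀ j : Fin q, j.val < m → ∀ l : ℕ, (-b j - (l : ℂ)).re < c) ∧
    (∀ k : Fin p, k.val < n → ∀ l : ℕ, c < (1 - a k + (l : ℂ)).re)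

/-- The point `c + i t` of the line `Re s = c`. -/
noncomputable def linePoint (c t : ℝ) : ℂ := (c : ℂ) + (t : ℂ) * Complex.I

/-- The Mellin-Barnes integral `(1 / 2πi) ∫_{c - i∞}^{c + i∞}` of the integrand
(with `ds = i dt` on the line `s = c + i t`). -/
noncomputable def meijerLineIntegral (m n : ℕ) {p q : ℕ} (a : Fin p → ℂ) (b : Fin q → ℂ)
    (z : ℂ) (c : ℝ) : ℂ :=
  1 / (2 * (Real.pi : ℂ) * Complex.I) *
    ∫ t : ℝ, meijerIntegrand m n a b z (linePoint c t) * Complex.I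

open Classical in
/-- The Meijer function `G^{m,n}_{p,q}(z | a ; b)`, for parameters whose two families of poles can
be separated by a vertical line: the Mellin-Barnes integral along such a line.
(For other parameters a curved contour would be needed; there the value is set to `0`.) -/
noncomputable def meijerG (m n : ℕ) {p q : ℕ} (a : Fin p → ℂ) (b : Fin q → ℂ) (z : ℂ) : ℂ :=
  if h : ∃ c : ℝ, MeijerSeparates m n a b c then meijerLineIntegral m n a b z h.choose else 0

/-- `G^{m,n}_{p,q}(z | a ; b)` is properly defined by its Mellin-Barnes integral: a separating line
exists, and along every separating line the integral converges absolutely, to the same value. -/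
def MeijerGWellDefined (m n : ℕ) {p q : ℕ} (a : Fin p → ℂ) (b : Fin q → ℂ) (z : ℂ) : Prop :=
  (∃ c : ℝ, MeijerSeparates m n a b c) ∧
    ∀ c : ℝ, MeijerSeparates m n a b c →
      Integrable (fun t : ℝ => meijerIntegrand m n a b z (linePoint c t)) ∧
        meijerLineIntegral m n a b z c = meijerG m n a b z

/-- The parameter vector `(1, 0, …, 0)` of length `p`. -/
def oneZeros (p : ℕ) : Fin p → ℂ := fun k => if k.val = 0 then 1 else 0

/-- The parameter vector `(1, 1, …, 1)` of length `q`. -/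
def allOnes (q : ℕ) : Fin q → ℂ := fun _ => 1

/-- The integrand of the double integral in the odd case. -/
noncomputable def oddKernel (n : ℕ) (z w t : ℝ) : ℝ :=
  Real.exp (-t) * (Real.sin ((z - Real.log t) * w) / (Real.pi * w)) *
    (Real.pi * w / Real.sinh (Real.pi * w)) ^ ((n - 1) / 2)

/-- The integrand of the single integral in the even case. -/
noncomputable def evenKernel (n : ℕ) (z w : ℝ) : ℝ :=
  Real.sin (z * w) / (Real.pi * w) * (Real.pi * w / Real.sinh (Real.pi * w)) ^ (n / 2)

/-! Almost surely `Z_n` is a sum of `n` independent terms `± ln X_i`, and `E exp (s ln X_i) = Γ(1 +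
s)` by Euler's integral. Hence on `|Re s| < 1` the two-sided Laplace transform of its law is `φ(s) =
Γ(1+s)^⌈n/2⌉ Γ(1-s)^⌊n/2⌋` (`integral_cexp_map_logRatioZ`). Both formulas use only this transform
and the absence of atoms.

(i) By Fubini, `x ↦ F(ln x)` has Mellin transform `-φ(s)/s` for `-1 < Re s < 0`, and Mellin
inversion recovers `F` on each such line (`cdf_eq_line_integral`). Since `Γ(-s) = -Γ(1-s)/s`, the
factor `-1/s` turns one `Γ(1-s)` into `Γ(-s)`, which is the upper parameter `1`; for `n = 1` it is
instead the quotient `Γ(-s)/Γ(1-s)`.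

(ii) Gil-Pelaez inversion (`cdf_eq_half_sub_integral`) uses `φ` on the imaginary axis, where
reflection gives `Γ(1+iw) Γ(1-iw) = πw / sinh(πw)`. For even `n` all factors pair up; for odd `n`
one `Γ(1+iw)` remains, and its Euler integral is the inner integral over `t`.

All convergence at infinity rests on `|φ(s)| ≤ C / |1+s|`, which one use of the functional equation
supplies. -/

/-! ### Mellin transform of a distribution function and its inversion -/

theorem continuous_cdf (μ : Measure ℝ) [IsProbabilityMeasure μ] [NullSingletonClass μ] :
    Continuous (cdf μ) := by
  refine continuous_iff_continuousAt.2 fun x => ?_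
  have h := (cdf μ).measure_singleton x
  rw [measure_cdf, measure_singleton, eq_comm, ENNReal.ofReal_eq_zero] at h
  rw [(monotone_cdf μ).continuousAt_iff_leftLim_eq_rightLim, (cdf μ).rightLim_eq]
  exact le_antisymm ((monotone_cdf μ).leftLim_le le_rfl) (by linarith)

/-- Supplies Fubini for `F(ln x) = ∫ 1_{e^y < x} dμ(y)`. Integrating the norm in `x` first leaves
`e^{σy} / (-σ)` with `σ = Re s`, so an exponential moment suffices. -/
theorem integrable_mellin_kernel (μ : Measure ℝ) [IsProbabilityMeasure μ] {s : ℂ} (hs : s.re < 0)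
    (hint : Integrable (fun y => Real.exp (s.re * y)) μ) :
    Integrable (Function.uncurry fun x y : ℝ =>
      (Ioi (Real.exp y)).indicator (fun x : ℝ => (x : ℂ) ^ (s - 1)) x)
      ((volume.restrict (Ioi 0)).prod μ) := by
  have hre : (s - 1).re < -1 := by rw [Complex.sub_re, Complex.one_re]; linarith
  have hind (y : ℝ) (f : ℝ → ℝ) : ∫ x in Ioi (0 : ℝ), (Ioi (Real.exp y)).indicator f x =
      ∫ x in Ioi (Real.exp y), f x := by
    rw [setIntegral_indicator measurableSet_Ioi]
    congr 2
    exact inter_eq_right.2 (Ioi_subset_Ioi (Real.exp_pos y).le)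
  have hmeas : Measurable (Function.uncurry fun x y : ℝ =>
      (Ioi (Real.exp y)).indicator (fun x : ℝ => (x : ℂ) ^ (s - 1)) x) := by
    have : (Function.uncurry fun x y : ℝ =>
        (Ioi (Real.exp y)).indicator (fun x : ℝ => (x : ℂ) ^ (s - 1)) x) =
        {p : ℝ × ℝ | Real.exp p.2 < p.1}.indicator (fun p => (p.1 : ℂ) ^ (s - 1)) := by
      ext p
      simp [Function.uncurry, indicator]
    rw [this]
    exact Measurable.indicator (by fun_prop) (measurableSet_lt (by fun_prop) (by fun_prop))
  refine (integrable_prod_iff' hmeas.aestronglyMeasurable).2 ⟨ae_of_all _ fun y => ?_, ?_⟩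
  · exact ((integrable_indicator_iff measurableSet_Ioi).2
      (integrableOn_Ioi_cpow_of_lt hre (Real.exp_pos y))).restrict
  · refine (hint.div_const (-s.re)).congr (ae_of_all _ fun y => ?_)
    simp only [Function.uncurry, norm_indicator_eq_indicator_norm]
    rw [hind, setIntegral_congr_fun (g := fun x : ℝ => x ^ (s.re - 1)) measurableSet_Ioi,
      integral_Ioi_rpow_of_lt (by simpa using hre) (Real.exp_pos y), ← Real.exp_mul]
    · rw [sub_add_cancel, mul_comm s.re, neg_div, div_neg]
    · intro x hx
      simpa using Complex.norm_cpow_eq_rpow_re_of_pos ((Real.exp_pos y).trans hx) (s - 1)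

theorem integral_mellin_kernel_right (μ : Measure ℝ) [IsProbabilityMeasure μ] [NullSingletonClass μ] (s : ℂ)
    {x : ℝ} (hx : 0 < x) :
    ∫ y, (Ioi (Real.exp y)).indicator (fun x : ℝ => (x : ℂ) ^ (s - 1)) x ∂μ =
      (x : ℂ) ^ (s - 1) • ((cdf μ (Real.log x) : ℝ) : ℂ) := by
  have : (fun y => (Ioi (Real.exp y)).indicator (fun x : ℝ => (x : ℂ) ^ (s - 1)) x) =
      (Iio (Real.log x)).indicator fun _ => (x : ℂ) ^ (s - 1) := by
    ext y
    simp [indicator, Real.lt_log_iff_exp_lt hx]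
  -- The kernel gives the mass of an open half-line, the cdf that of a closed one; they agree
  -- because there are no atoms.
  rw [this, integral_indicator measurableSet_Iio, cdf_eq_real,
    ← measureReal_congr (Iio_ae_eq_Iic (μ := μ) (a := Real.log x))]
  simp [mul_comm]

theorem mellinConvergent_cdf (μ : Measure ℝ) [IsProbabilityMeasure μ] [NullSingletonClass μ] {s : ℂ}
    (hs : s.re < 0) (hint : Integrable (fun y => Real.exp (s.re * y)) μ) :
    MellinConvergent (fun x => ((cdf μ (Real.log x) : ℝ) : ℂ)) s := by
  refine (integrable_mellin_kernel μ hs hint).integral_prod_left.congr ?_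
  filter_upwards [ae_restrict_mem measurableSet_Ioi] with x hx
  exact integral_mellin_kernel_right μ s hx

theorem mellin_cdf (μ : Measure ℝ) [IsProbabilityMeasure μ] [NullSingletonClass μ] {s : ℂ}
    (hs : s.re < 0) (hint : Integrable (fun y => Real.exp (s.re * y)) μ) :
    mellin (fun x => ((cdf μ (Real.log x) : ℝ) : ℂ)) s =
      -(∫ y : ℝ, Complex.exp (s * y) ∂μ) / s := by
  have hre : (s - 1).re < -1 := by rw [Complex.sub_re, Complex.one_re]; linarith
  rw [mellin, setIntegral_congr_fun measurableSet_Ioi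
    (fun x hx => (integral_mellin_kernel_right μ s hx).symm),
    integral_integral_swap (integrable_mellin_kernel μ hs hint), ← integral_neg, ← integral_div]
  congr 1 with y
  rw [setIntegral_indicator measurableSet_Ioi,
    inter_eq_right.2 (Ioi_subset_Ioi (Real.exp_pos y).le),
    integral_Ioi_cpow_of_lt hre (Real.exp_pos y), sub_add_cancel,
    Complex.cpow_def_of_ne_zero (by simp), ← Complex.ofReal_log (Real.exp_pos y).le, Real.log_exp,
    mul_comm]

/-- The distribution function as an inverse two-sided Laplace transform. -/
theorem cdf_eq_line_integral (μ : Measure ℝ) [IsProbabilityMeasure μ] [NullSingletonClass μ] {σ : ℝ}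
    (hσ : σ < 0) (hint : Integrable (fun y => Real.exp (σ * y)) μ)
    (hline : Integrable fun t : ℝ => (∫ y : ℝ, Complex.exp ((σ + t * Complex.I) * y) ∂μ) /
      (σ + t * Complex.I)) (z : ℝ) :
    ((cdf μ z : ℝ) : ℂ) = 1 / (2 * Real.pi) * ∫ t : ℝ, (Real.exp z : ℂ) ^ (-(σ + t * Complex.I)) *
      (-(∫ y : ℝ, Complex.exp ((σ + t * Complex.I) * y) ∂μ) / (σ + t * Complex.I)) := by
  have hmel (t : ℝ) : mellin (fun x => ((cdf μ (Real.log x) : ℝ) : ℂ)) (σ + t * Complex.I) =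
      -(∫ y : ℝ, Complex.exp ((σ + t * Complex.I) * y) ∂μ) / (σ + t * Complex.I) :=
    mellin_cdf μ (by simpa) (by simpa)
  have h := mellinInv_mellin_eq σ (fun x => ((cdf μ (Real.log x) : ℝ) : ℂ)) (Real.exp_pos z)
    (mellinConvergent_cdf μ (by simpa) (by simpa)) ?_ ?_
  · rw [Real.log_exp] at h
    rw [← h, mellinInv]
    simp_rw [hmel, smul_eq_mul, Complex.real_smul]
    push_cast
    rfl
  · simp only [Complex.VerticalIntegrable, hmel, neg_div]
    exact hline.neg
  · exact Complex.continuous_ofReal.continuousAt.comp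
      ((continuous_cdf μ).continuousAt.comp
        (Real.continuousAt_log (Real.exp_pos z).ne'))

/-! ### Gil-Pelaez inversion by Abel summation -/

theorem integral_exp_neg_mul_cos_Ioi {ε : ℝ} (hε : 0 < ε) (a : ℝ) :
    ∫ w in Ioi (0 : ℝ), Real.exp (-ε * w) * Real.cos (w * a) = ε / (ε ^ 2 + a ^ 2) := by
  have hre : (-(ε : ℂ) + a * Complex.I).re < 0 := by simpa
  have h := integral_exp_mul_complex_Ioi hre 0
  have h2 := congrArg Complex.re h
  rw [← RCLike.re_eq_complex_re, ← integral_re (integrableOn_exp_mul_complex_Ioi hre 0)] at h2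
  rw [setIntegral_congr_fun measurableSet_Ioi (g := fun w : ℝ =>
    RCLike.re (Complex.exp ((-(ε : ℂ) + a * Complex.I) * w))), h2]
  · simp [Complex.div_re, Complex.normSq_apply]
    ring
  · intro w _
    simp [Complex.exp_re, mul_comm]

theorem integrableOn_exp_neg_mul_sin_div_Ioi {ε : ℝ} (hε : 0 < ε) (a : ℝ) :
    IntegrableOn (fun w => Real.exp (-ε * w) * (Real.sin (w * a) / w)) (Ioi 0) := by
  refine ((integrableOn_exp_mul_Ioi (neg_lt_zero.2 hε) 0).mul_const |a|).mono'
    (Measurable.aestronglyMeasurable (by fun_prop)) ?_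
  filter_upwards [ae_restrict_mem measurableSet_Ioi] with w (hw : 0 < w)
  rw [norm_mul, Real.norm_eq_abs, Real.abs_exp, norm_div, Real.norm_eq_abs, Real.norm_eq_abs,
    abs_of_pos hw]
  gcongr
  rw [div_le_iff₀ hw]
  calc _ ≤ |w * a| := Real.abs_sin_le_abs
    _ = _ := by rw [abs_mul, abs_of_pos hw, mul_comm]

/-- The Laplace transform of `w ↦ sin (w a) / w`. -/
theorem integral_exp_neg_mul_sin_div_Ioi {ε : ℝ} (hε : 0 < ε) (a : ℝ) :
    ∫ w in Ioi (0 : ℝ), Real.exp (-ε * w) * (Real.sin (w * a) / w) = Real.arctan (a / ε) := by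
  -- Differentiating in `a` removes the division by `w`; the derivative is that of `arctan (a / ε)`,
  -- and both functions vanish at `a = 0`.
  set F : ℝ → ℝ := fun a => ∫ w in Ioi (0 : ℝ), Real.exp (-ε * w) * (Real.sin (w * a) / w)
  have hF (a : ℝ) : HasDerivAt F (ε / (ε ^ 2 + a ^ 2)) a := by
    rw [← integral_exp_neg_mul_cos_Ioi hε]
    refine (hasDerivAt_integral_of_dominated_loc_of_deriv_le
      (F := fun a w => Real.exp (-ε * w) * (Real.sin (w * a) / w))
      (F' := fun a w => Real.exp (-ε * w) * Real.cos (w * a))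
      (bound := fun w => Real.exp (-ε * w)) Filter.univ_mem
      (Filter.Eventually.of_forall fun a => Measurable.aestronglyMeasurable (by fun_prop))
      (integrableOn_exp_neg_mul_sin_div_Ioi hε a)
      (Measurable.aestronglyMeasurable (by fun_prop))
      (ae_of_all _ fun w a _ => ?_) (integrableOn_exp_mul_Ioi (neg_lt_zero.2 hε) 0) ?_).2
    · rw [norm_mul, Real.norm_eq_abs, Real.abs_exp]
      exact mul_le_of_le_one_right (Real.exp_pos _).le (Real.abs_cos_le_one _)
    · filter_upwards [ae_restrict_mem measurableSet_Ioi] with w (hw : 0 < w) a _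
      have := (((((hasDerivAt_id a).const_mul w).sin).div_const w).const_mul (Real.exp (-ε * w)))
      refine this.congr_deriv ?_
      simp [hw.ne']
  have hG (a : ℝ) : HasDerivAt (fun a => F a - Real.arctan (a / ε)) 0 a := by
    refine ((hF a).sub ((hasDerivAt_id a).div_const ε).arctan).congr_deriv ?_
    have : ε ^ 2 + a ^ 2 ≠ 0 := by positivity
    simp only [id]
    field_simp
    ring
  have := is_const_of_deriv_eq_zero (fun a => (hG a).differentiableAt) (fun a => (hG a).deriv) a 0
  simpa [F, sub_eq_zero] using this

/-- The limit `ε = 1/(n+1) → 0` of the damped sine integral. The branch `a ≤ 0` is chosen to match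
the indicator of `Iic z` when `a = y - z`. -/
theorem tendsto_arctan_mul_natCast (a : ℝ) (ha : a ≠ 0) :
    Filter.Tendsto (fun n : ℕ => Real.arctan (a / (1 / ((n : ℝ) + 1)))) Filter.atTop
      (nhds (if a ≤ 0 then -(Real.pi / 2) else Real.pi / 2)) := by
  have hn : Filter.Tendsto (fun n : ℕ => (n : ℝ) + 1) Filter.atTop Filter.atTop :=
    Filter.tendsto_atTop_add_const_right _ _ tendsto_natCast_atTop_atTop
  simp only [div_div_eq_mul_div, div_one]
  split_ifs with h
  · exact (Real.tendsto_arctan_atBot.mono_right nhdsWithin_le_nhds).comp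
      (hn.const_mul_atTop_of_neg (lt_of_le_of_ne h ha))
  · exact (Real.tendsto_arctan_atTop.mono_right nhdsWithin_le_nhds).comp
      (hn.const_mul_atTop (not_le.1 h))

/-- The Gil-Pelaez inversion formula. -/
theorem cdf_eq_half_sub_integral (μ : Measure ℝ) [IsProbabilityMeasure μ] [NullSingletonClass μ]
    (hμ : Integrable (fun y => y) μ) (z : ℝ)
    (hint : IntegrableOn (fun w => (∫ y, Real.sin (w * (y - z)) ∂μ) / w) (Ioi 0)) :
    cdf μ z = 1 / 2 - 1 / Real.pi *
      ∫ w in Ioi (0 : ℝ), (∫ y, Real.sin (w * (y - z)) ∂μ) / w := by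
  -- The damping `e^{-εw}` makes the double integral absolutely convergent: `|sin (w(y-z)) / w| ≤
  -- |y-z|`, which the first moment controls. Then `ε → 0` on both sides by dominated convergence.
  have hswap {ε : ℝ} (hε : 0 < ε) :
      ∫ w in Ioi (0 : ℝ), Real.exp (-ε * w) * ((∫ y, Real.sin (w * (y - z)) ∂μ) / w) =
        ∫ y, Real.arctan ((y - z) / ε) ∂μ := by
    have h1 : Integrable (Function.uncurry fun w y : ℝ =>
        Real.exp (-ε * w) * (Real.sin (w * (y - z)) / w)) ((volume.restrict (Ioi 0)).prod μ) := by
      have hz : Integrable (fun y => |y - z|) μ := (hμ.sub (integrable_const z)).abs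
      refine ((integrableOn_exp_mul_Ioi (neg_lt_zero.2 hε) 0).mul_prod hz).mono'
        (Measurable.aestronglyMeasurable (by unfold Function.uncurry; fun_prop)) ?_
      refine ae_of_all _ fun p => ?_
      simp only [Function.uncurry]
      rw [norm_mul, Real.norm_eq_abs, Real.abs_exp, norm_div, Real.norm_eq_abs, Real.norm_eq_abs]
      gcongr
      refine div_le_of_le_mul₀ (abs_nonneg _) (abs_nonneg _) ?_
      rw [mul_comm, ← abs_mul]
      exact Real.abs_sin_le_abs
    have h2 := integral_integral_swap h1
    simp_rw [integral_exp_neg_mul_sin_div_Ioi hε] at h2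
    rw [← h2]
    simp_rw [integral_const_mul, integral_div]
  have hpos (n : ℕ) : (0 : ℝ) < 1 / ((n : ℝ) + 1) := by positivity
  have hL : Filter.Tendsto (fun n : ℕ => ∫ w in Ioi (0 : ℝ), Real.exp (-(1 / ((n : ℝ) + 1)) * w) *
      ((∫ y, Real.sin (w * (y - z)) ∂μ) / w)) Filter.atTop
      (nhds (∫ w in Ioi (0 : ℝ), (∫ y, Real.sin (w * (y - z)) ∂μ) / w)) := by
    refine tendsto_integral_of_dominated_convergence _
      (fun n => (Continuous.aestronglyMeasurable (by fun_prop)).mul hint.1) hint.norm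
      (fun n => ?_) (ae_of_all _ fun w => ?_)
    · filter_upwards [ae_restrict_mem measurableSet_Ioi] with w (hw : 0 < w)
      rw [norm_mul, Real.norm_eq_abs, Real.abs_exp]
      refine mul_le_of_le_one_left (norm_nonneg _) (Real.exp_le_one_iff.2 ?_)
      have := mul_pos (hpos n) hw
      linarith
    · have h := (tendsto_one_div_add_atTop_nhds_zero_nat (𝕜 := ℝ)).neg.mul_const w
      have := ((Real.continuous_exp.tendsto _).comp h).mul_const
        ((∫ y, Real.sin (w * (y - z)) ∂μ) / w)
      simpa using this
  have hR : Filter.Tendsto (fun n : ℕ => ∫ y, Real.arctan ((y - z) / (1 / ((n : ℝ) + 1))) ∂μ)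
      Filter.atTop (nhds (∫ y, (if y - z ≤ 0 then -(Real.pi / 2) else Real.pi / 2) ∂μ)) := by
    refine tendsto_integral_of_dominated_convergence (fun _ => Real.pi / 2)
      (fun n => Continuous.aestronglyMeasurable
        (Real.continuous_arctan.comp (by fun_prop)))
      (integrable_const _) (fun n => ae_of_all _ fun y => ?_) ?_
    · exact abs_le.2 ⟨(Real.neg_pi_div_two_lt_arctan _).le, (Real.arctan_lt_pi_div_two _).le⟩
    · filter_upwards [μ.ae_ne z] with y hy
      exact tendsto_arctan_mul_natCast _ (sub_ne_zero.2 hy)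
  simp_rw [hswap (hpos _)] at hL
  have heq := tendsto_nhds_unique hL hR
  have hval : ∫ y, (if y - z ≤ 0 then -(Real.pi / 2) else Real.pi / 2) ∂μ =
      Real.pi / 2 - Real.pi * cdf μ z := by
    have : (fun y : ℝ => if y - z ≤ 0 then -(Real.pi / 2) else Real.pi / 2) =
        fun y => Real.pi / 2 - (Iic z).indicator (fun _ => Real.pi) y := by
      ext y
      simp only [indicator, mem_Iic, sub_nonpos]
      split_ifs <;> ring
    rw [this, integral_sub (integrable_const _)
      ((integrable_const _).indicator measurableSet_Iic), integral_indicator measurableSet_Iic,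
      cdf_eq_real]
    simp [mul_comm]
  rw [heq, hval]
  field_simp
  ring

/-! ### Bounds for Gamma products on vertical lines -/

theorem norm_Gamma_le {s : ℂ} (hs : 0 < s.re) : ‖Complex.Gamma s‖ ≤ Real.Gamma s.re := by
  rw [Complex.Gamma_eq_integral hs, Real.Gamma_eq_integral hs, Complex.GammaIntegral]
  refine (norm_integral_le_integral_norm _).trans (le_of_eq ?_)
  refine setIntegral_congr_fun measurableSet_Ioi fun x hx => ?_
  simp [Complex.norm_cpow_eq_rpow_re_of_pos hx, Complex.norm_exp]

/-- Writing `Γ(1+s) = Γ(2+s) / (1+s)` and bounding only the numerator gains one power of decay, with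
no need of Stirling. -/
theorem norm_Gamma_one_add_le {s : ℂ} (hs : -1 < s.re) :
    ‖Complex.Gamma (1 + s)‖ ≤ Real.Gamma (2 + s.re) / ‖1 + s‖ := by
  have hpos : 0 < (1 + s).re := by simp; linarith
  have hne : 1 + s ≠ 0 := fun h => by simp [h] at hpos
  rw [le_div_iff₀ (norm_pos_iff.2 hne), mul_comm, ← norm_mul, ← Complex.Gamma_add_one _ hne]
  have h := norm_Gamma_le (s := 1 + s + 1) (by rw [Complex.add_re, Complex.one_re]; linarith)
  rwa [show (1 + s + 1).re = 2 + s.re by simp; ring] at h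

/-- Moment generating function of an alternating sum of logarithms of standard exponential
variables with `a` plus and `b` minus signs. -/
noncomputable def gammaProd (a b : ℕ) (s : ℂ) : ℂ :=
  Complex.Gamma (1 + s) ^ a * Complex.Gamma (1 - s) ^ b

/-- One factor `Γ(1+s)` provides the decay, hence `1 ≤ a`; the others are merely bounded on the
line. -/
theorem norm_gammaProd_le {a : ℕ} (ha : 1 ≤ a) (b : ℕ) {σ : ℝ} (h1 : -1 < σ) (h2 : σ < 1) :
    ∃ C : ℝ, 0 ≤ C ∧ ∀ s : ℂ, s.re = σ → ‖gammaProd a b s‖ ≤ C / ‖1 + s‖ := by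
  have p1 : 0 < Real.Gamma (1 + σ) := Real.Gamma_pos_of_pos (by linarith)
  have p2 : 0 < Real.Gamma (1 - σ) := Real.Gamma_pos_of_pos (by linarith)
  have p3 : 0 < Real.Gamma (2 + σ) := Real.Gamma_pos_of_pos (by linarith)
  refine ⟨Real.Gamma (1 + σ) ^ (a - 1) * Real.Gamma (2 + σ) * Real.Gamma (1 - σ) ^ b,
    by positivity, ?_⟩
  rintro s rfl
  obtain ⟨k, rfl⟩ := Nat.exists_eq_add_of_le' ha
  have e1 : ‖Complex.Gamma (1 + s)‖ ≤ Real.Gamma (1 + s.re) := by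
    simpa using norm_Gamma_le (s := 1 + s) (by simp; linarith)
  have e2 : ‖Complex.Gamma (1 - s)‖ ≤ Real.Gamma (1 - s.re) := by
    simpa using norm_Gamma_le (s := 1 - s) (by simp; linarith)
  rw [gammaProd, norm_mul, norm_pow, norm_pow, pow_succ, Nat.add_sub_cancel, mul_div_right_comm,
    mul_div_assoc]
  gcongr
  exact norm_Gamma_one_add_le h1

theorem differentiableAt_gammaProd (a b : ℕ) {s : ℂ} (h1 : -1 < s.re) (h2 : s.re < 1) :
    DifferentiableAt ℂ (gammaProd a b) s := by
  have key (u : ℂ) (hu : 0 < u.re) : DifferentiableAt ℂ Complex.Gamma u := by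
    refine Complex.differentiableAt_Gamma _ fun m h => ?_
    rw [h] at hu
    simp at hu
    linarith [Nat.cast_nonneg (α := ℝ) m]
  have k1 := key (1 + s) (by simp; linarith)
  have k2 := key (1 - s) (by simp; linarith)
  unfold gammaProd
  exact ((k1.comp s (by fun_prop)).pow a).mul ((k2.comp s (by fun_prop)).pow b)

theorem le_norm_add_mul_I {x δ : ℝ} (hδ : 0 ≤ δ) (hδ1 : δ ≤ 1) (hx : δ ≤ |x|) (t : ℝ) :
    δ * √(1 + t ^ 2) ≤ ‖(x : ℂ) + t * Complex.I‖ := by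
  rw [Complex.norm_add_mul_I, ← Real.sqrt_sq hδ, ← Real.sqrt_mul (sq_nonneg δ)]
  refine Real.sqrt_le_sqrt ?_
  have : δ ^ 2 ≤ x ^ 2 := by rw [← sq_abs x]; gcongr
  have : δ ^ 2 ≤ 1 := pow_le_one₀ hδ hδ1
  nlinarith [sq_nonneg t]

theorem integrable_gammaProd_div {a : ℕ} (ha : 1 ≤ a) (b : ℕ) {σ : ℝ} (h1 : -1 < σ) (h2 : σ < 0) :
    Integrable fun t : ℝ =>
      gammaProd a b (σ + t * Complex.I) / (σ + t * Complex.I) := by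
  obtain ⟨C, hC, hb⟩ := norm_gammaProd_le ha b h1 (h2.trans one_pos)
  -- The distance from `σ` to the ends of the strip: `|s|` and `|1+s|` are both at least `δ
  -- √(1+t²)`, so the quotient is `O(1/(1+t²))`.
  set δ := min (-σ) (1 + σ)
  have hδ : 0 < δ := lt_min (by linarith) (by linarith)
  have hδ1 : δ ≤ 1 := by
    rcases le_total (-σ) (1 + σ) with h | h
    · exact (min_le_left _ _).trans (by linarith)
    · exact (min_le_right _ _).trans (by linarith)
  have hre (t : ℝ) : ((σ : ℂ) + t * Complex.I).re = σ := by simp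
  have hne (t : ℝ) : (σ : ℂ) + t * Complex.I ≠ 0 := fun h => by
    have := hre t
    rw [h] at this
    simp at this
    linarith
  refine (integrable_inv_one_add_sq.const_mul (C / δ ^ 2)).mono' ?_ (ae_of_all _ fun t => ?_)
  · refine (continuous_iff_continuousAt.2 fun t => ?_).aestronglyMeasurable
    refine ContinuousAt.div ?_ (by fun_prop) (hne t)
    exact ContinuousAt.comp (f := fun t : ℝ => (σ : ℂ) + t * Complex.I)
      (differentiableAt_gammaProd a b (by rw [hre]; exact h1)
        (by rw [hre]; linarith)).continuousAt (by fun_prop)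
  · have n1 := le_norm_add_mul_I hδ.le hδ1
      (show δ ≤ |σ| by rw [abs_of_neg h2]; exact min_le_left _ _) t
    have n2 := le_norm_add_mul_I hδ.le hδ1
      (show δ ≤ |1 + σ| by rw [abs_of_pos (by linarith)]; exact min_le_right _ _) t
    have hs : 0 < √(1 + t ^ 2) := Real.sqrt_pos.2 (by positivity)
    have e := hb _ (hre t)
    rw [norm_div]
    calc _ ≤ C / ‖1 + ((σ : ℂ) + t * Complex.I)‖ / ‖(σ : ℂ) + t * Complex.I‖ := by gcongr
      _ ≤ C / (δ * √(1 + t ^ 2)) / (δ * √(1 + t ^ 2)) := by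
        have n3 : δ * √(1 + t ^ 2) ≤ ‖1 + ((σ : ℂ) + t * Complex.I)‖ := by
          rw [← add_assoc]
          exact_mod_cast n2
        gcongr
      _ = C / δ ^ 2 * (1 + t ^ 2)⁻¹ := by
        rw [div_div, mul_mul_mul_comm, Real.mul_self_sqrt (by positivity)]
        field_simp

theorem exists_norm_gammaProd_mul_I_le {a : ℕ} (ha : 1 ≤ a) (b : ℕ) :
    ∃ C : ℝ, 0 ≤ C ∧ ∀ w : ℝ, 0 < w → ‖gammaProd a b (w * Complex.I)‖ ≤ C / w := by
  obtain ⟨C, hC, hb⟩ := norm_gammaProd_le ha b (σ := 0) (by norm_num) one_pos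
  refine ⟨C, hC, fun w hw => (hb _ (by simp)).trans ?_⟩
  gcongr
  simpa [abs_of_pos hw] using Complex.abs_im_le_norm (1 + (w : ℂ) * Complex.I)

/-- `Γ(1+iw) = iw Γ(iw)`, then Euler's reflection formula at `iw`. -/
theorem Gamma_one_add_mul_Gamma_one_sub_mul_I {w : ℝ} (hw : w ≠ 0) :
    Complex.Gamma (1 + w * Complex.I) * Complex.Gamma (1 - w * Complex.I) =
      ((Real.pi * w / Real.sinh (Real.pi * w) : ℝ) : ℂ) := by
  have hwI : (w : ℂ) * Complex.I ≠ 0 := by simp [hw]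
  rw [add_comm, Complex.Gamma_add_one _ hwI, mul_assoc, Complex.Gamma_mul_Gamma_one_sub,
    ← mul_assoc, Complex.sin_mul_I]
  push_cast
  have : Complex.sinh (Real.pi * w) ≠ 0 := by
    have h : Real.sinh (Real.pi * w) ≠ 0 := by simp [Real.pi_ne_zero, hw]
    exact_mod_cast h
  field_simp

/-! ### The law of the alternating sum of logarithms -/

theorem expMeasure_one_eq :
    expMeasure 1 = (volume.restrict (Ioi 0)).withDensity fun x => ENNReal.ofReal (Real.exp (-x)) := by
  rw [expMeasure, gammaMeasure, ← withDensity_indicator measurableSet_Ioi]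
  refine withDensity_congr_ae ?_
  -- The two densities differ at `0`, a null set.
  filter_upwards [volume.ae_ne (0 : ℝ)] with x hx
  rcases lt_or_gt_of_ne hx with h | h
  · simp [gammaPDF_of_neg h, h.le]
  · simp [gammaPDF_of_nonneg h.le, h]

theorem integral_expMeasure_one {E : Type*} [NormedAddCommGroup E] [NormedSpace ℝ E] (f : ℝ → E) :
    ∫ x, f x ∂(expMeasure 1) = ∫ x in Ioi (0 : ℝ), Real.exp (-x) • f x := by
  rw [expMeasure_one_eq, integral_withDensity_eq_integral_toReal_smul (by fun_prop) (by simp)]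
  simp [Real.exp_nonneg]

theorem ae_pos_expMeasure_one : ∀ᵐ x ∂(expMeasure 1), 0 < x := by
  rw [expMeasure_one_eq]
  exact (withDensity_absolutelyContinuous _ _).ae_le (ae_restrict_mem measurableSet_Ioi)

theorem expMeasure_one_absolutelyContinuous : expMeasure 1 ≪ volume := by
  rw [expMeasure_one_eq]
  exact (withDensity_absolutelyContinuous _ _).trans
    (Measure.absolutelyContinuous_of_le Measure.restrict_le_self)

theorem integral_cexp_mul_log_expMeasure_one {s : ℂ} (hs : -1 < s.re) :
    ∫ x, Complex.exp (s * Real.log x) ∂(expMeasure 1) = Complex.Gamma (1 + s) := by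
  rw [integral_expMeasure_one, Complex.Gamma_eq_integral (by simp; linarith),
    Complex.GammaIntegral]
  refine setIntegral_congr_fun measurableSet_Ioi fun x (hx : 0 < x) => ?_
  simp only [Complex.real_smul]
  rw [add_sub_cancel_left, Complex.cpow_def_of_ne_zero (by simpa using hx.ne'),
    ← Complex.ofReal_log hx.le, mul_comm s]

theorem neg_one_pow_sub_eq_ite {i n : ℕ} (h : i ≤ n) :
    (-1 : ℝ) ^ (n - i) = if i % 2 = n % 2 then 1 else -1 := by
  split_ifs with hp
  · exact Even.neg_one_pow (by rw [Nat.even_iff]; omega)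
  · exact Odd.neg_one_pow (by rw [Nat.odd_iff]; omega)

theorem logRatioZ_eq_sum {Ω : Type*} (X : ℕ → Ω → ℝ) (n : ℕ) (ω : Ω)
    (h : ∀ i, 1 ≤ i → 0 < X i ω) :
    logRatioZ X n ω = ∑ i ∈ Finset.Icc 1 n, (-1 : ℝ) ^ (n - i) * Real.log (X i ω) := by
  have hne (p : ℕ → Prop) [DecidablePred p] : ∀ i ∈ (Finset.Icc 1 n).filter p, X i ω ≠ 0 :=
    fun i hi => (h i (Finset.mem_Icc.1 (Finset.mem_filter.1 hi).1).1).ne'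
  rw [logRatioZ, ratioY, Real.log_div (Finset.prod_ne_zero_iff.2 (hne _))
    (Finset.prod_ne_zero_iff.2 (hne _)), Real.log_prod (hne _), Real.log_prod (hne _),
    Finset.sum_filter, Finset.sum_filter, ← Finset.sum_sub_distrib]
  refine Finset.sum_congr rfl fun i hi => ?_
  rw [neg_one_pow_sub_eq_ite (Finset.mem_Icc.1 hi).2]
  split_ifs <;> simp_all

/-- Given the first summand, the second must hit one prescribed point; so it is enough that one of
the two laws has no atoms. -/
theorem nullSingletonClass_conv (μ ν : Measure ℝ) [SFinite μ] [SFinite ν] [NullSingletonClass ν] :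
    NullSingletonClass (μ.conv ν) := by
  refine ⟨fun z => ?_⟩
  rw [← lintegral_indicator_one (measurableSet_singleton z),
    Measure.lintegral_conv (measurable_one.indicator (measurableSet_singleton z))]
  have (x : ℝ) : ∫⁻ y, ({z} : Set ℝ).indicator 1 (x + y) ∂ν = 0 := by
    have : (fun y => ({z} : Set ℝ).indicator (1 : ℝ → ENNReal) (x + y)) =
        ({z - x} : Set ℝ).indicator 1 := by
      ext y
      simp [indicator, eq_sub_iff_add_eq, add_comm]
    rw [this, lintegral_indicator_one (measurableSet_singleton _), measure_singleton]
  simp only [this, lintegral_zero]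

theorem prod_Gamma_alternating (s : ℂ) (n : ℕ) :
    ∏ j ∈ Finset.range n, Complex.Gamma (1 + (-1) ^ j * s) = gammaProd ((n + 1) / 2) (n / 2) s := by
  induction n with
  | zero => simp [gammaProd]
  | succ n ih =>
    rw [Finset.prod_range_succ, ih, gammaProd, gammaProd]
    rcases Nat.even_or_odd' n with ⟨k, rfl | rfl⟩
    · rw [show (2 * k + 1) / 2 = k by omega, show 2 * k / 2 = k by omega,
        show (2 * k + 1 + 1) / 2 = k + 1 by omega, (even_two_mul k).neg_one_pow, one_mul]
      ring
    · rw [show (2 * k + 1 + 1) / 2 = k + 1 by omega, show (2 * k + 1) / 2 = k by omega,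
        show (2 * k + 1 + 1 + 1) / 2 = k + 1 by omega, (odd_two_mul_add_one k).neg_one_pow,
        neg_one_mul, ← sub_eq_add_neg]
      ring

section Law

variable {Ω : Type*} [MeasurableSpace Ω] {P : Measure Ω} {X : ℕ → Ω → ℝ}

theorem logRatioZ_ae_eq_sum (hlaw : ∀ i : ℕ, 1 ≤ i → HasLaw (X i) (expMeasure 1) P) (n : ℕ) :
    ∀ᵐ ω ∂P, logRatioZ X n ω = ∑ i ∈ Finset.Icc 1 n, (-1 : ℝ) ^ (n - i) * Real.log (X i ω) := by
  have : ∀ᵐ ω ∂P, ∀ i, 1 ≤ i → 0 < X i ω := by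
    rw [ae_all_iff]
    intro i
    by_cases hi : 1 ≤ i
    · have h := ae_pos_expMeasure_one
      rw [← (hlaw i hi).map_eq] at h
      filter_upwards [ae_of_ae_map (hlaw i hi).aemeasurable h] with ω hω _ using hω
    · exact ae_of_all _ fun ω h => absurd h hi
  filter_upwards [this] with ω hω using logRatioZ_eq_sum X n ω hω

theorem logRatioZ_ae_eq_sum_range (hlaw : ∀ i : ℕ, 1 ≤ i → HasLaw (X i) (expMeasure 1) P) (n : ℕ) :
    logRatioZ X n =ᵐ[P] ∑ j ∈ Finset.range n, fun ω =>
      (-1 : ℝ) ^ (n - 1 - j) * Real.log (X (j + 1) ω) := by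
  filter_upwards [logRatioZ_ae_eq_sum hlaw n] with ω hω
  have h := Finset.sum_Ico_add' (fun i => (-1 : ℝ) ^ (n - i) * Real.log (X i ω)) 0 n 1
  rw [hω, Finset.sum_apply, Finset.range_eq_Ico]
  refine h.symm.trans (Finset.sum_congr rfl fun j _ => ?_)
  rw [Nat.sub_sub, add_comm 1]

theorem nullSingletonClass_map_logRatioZ [IsProbabilityMeasure P]
    (hlaw : ∀ i : ℕ, 1 ≤ i → HasLaw (X i) (expMeasure 1) P)
    (hindep : iIndepFun (fun i : ℕ => X (i + 1)) P) {n : ℕ} (hn : 1 ≤ n) :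
    NullSingletonClass (P.map (logRatioZ X n)) := by
  obtain ⟨m, rfl⟩ := Nat.exists_eq_add_of_le' hn
  have hm (j : ℕ) : AEMeasurable (X (j + 1)) P := (hlaw _ (by omega)).aemeasurable
  rw [Measure.map_congr (logRatioZ_ae_eq_sum_range hlaw _), Finset.sum_range_succ]
  have hind : iIndepFun (fun j ω => (-1 : ℝ) ^ (m + 1 - 1 - j) * Real.log (X (j + 1) ω)) P :=
    hindep.comp (fun j x => (-1 : ℝ) ^ (m + 1 - 1 - j) * Real.log x) fun j => by fun_prop
  have hmeas (j : ℕ) : AEMeasurable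
      (fun ω => (-1 : ℝ) ^ (m + 1 - 1 - j) * Real.log (X (j + 1) ω)) P :=
    (Real.measurable_log.comp_aemeasurable (hm j)).const_mul _
  rw [(hind.indepFun_finsetSum_of_notMem₀ hmeas Finset.notMem_range_self).map_add_eq_map_conv_map₀
    (Finset.aemeasurable_sum _ fun j _ => hmeas j) (hmeas m)]
  have : NullSingletonClass
      (P.map fun ω => (-1 : ℝ) ^ (m + 1 - 1 - m) * Real.log (X (m + 1) ω)) := by
    refine ⟨fun r => ?_⟩
    -- `Real.log` is `log |x|` on negative reals and `0` at `0`, hence three candidate preimages.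
    have hsub : Real.log ⁻¹' {r} ⊆ {0, Real.exp r, -Real.exp r} := by
      rintro x rfl
      rcases lt_trichotomy x 0 with h | h | h
      · simp [Real.exp_log_of_neg h]
      · simp [h]
      · simp [Real.exp_log h]
    rw [Measure.map_apply_of_aemeasurable (hmeas m) (measurableSet_singleton r)]
    have : (fun ω => (-1 : ℝ) ^ (m + 1 - 1 - m) * Real.log (X (m + 1) ω)) ⁻¹' {r} =
        X (m + 1) ⁻¹' (Real.log ⁻¹' {r}) := by
      ext ω
      simp
    rw [this, ← Measure.map_apply_of_aemeasurable (hm m)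
      (Real.measurable_log (measurableSet_singleton r)), (hlaw _ (by omega)).map_eq]
    exact expMeasure_one_absolutelyContinuous
      (measure_mono_null hsub (Set.Finite.measure_zero (by simp) _))
  exact nullSingletonClass_conv _ _

theorem integral_cexp_map_logRatioZ
    (hlaw : ∀ i : ℕ, 1 ≤ i → HasLaw (X i) (expMeasure 1) P)
    (hindep : iIndepFun (fun i : ℕ => X (i + 1)) P) (n : ℕ) {s : ℂ}
    (h1 : -1 < s.re) (h2 : s.re < 1) :
    ∫ y : ℝ, Complex.exp (s * y) ∂(P.map (logRatioZ X n)) =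
      gammaProd ((n + 1) / 2) (n / 2) s := by
  have hm (j : ℕ) : AEMeasurable (X (j + 1)) P := (hlaw _ (by omega)).aemeasurable
  have hmeas (j : ℕ) : AEMeasurable
      (fun ω => (-1 : ℝ) ^ (n - 1 - j) * Real.log (X (j + 1) ω)) P :=
    (Real.measurable_log.comp_aemeasurable (hm j)).const_mul _
  have hind : iIndepFun (fun j : Fin n => X (j.val + 1)) P :=
    hindep.precomp (g := Fin.val) Fin.val_injective
  -- Reversing the order of the factors turns the sign `(-1)^j` into `(-1)^(n-1-j)`, since the last
  -- variable carries the plus sign.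
  rw [Measure.map_congr (logRatioZ_ae_eq_sum_range hlaw _),
    integral_map (Finset.aemeasurable_sum _ fun j _ => hmeas j)
      (Continuous.aestronglyMeasurable (by fun_prop)), ← prod_Gamma_alternating,
    ← Finset.prod_range_reflect, Finset.prod_range]
  have hfac (j : ℕ) : ∫ ω, Complex.exp ((-1) ^ (n - 1 - j) * s * Real.log (X (j + 1) ω)) ∂P =
      Complex.Gamma (1 + (-1) ^ (n - 1 - j) * s) := by
    rw [← integral_cexp_mul_log_expMeasure_one, ← (hlaw (j + 1) (by omega)).map_eq,
      integral_map (hm j) (Measurable.aestronglyMeasurable (by fun_prop))]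
    rcases neg_one_pow_eq_or ℂ (n - 1 - j) with h | h <;> rw [h] <;> simp <;> linarith
  simp_rw [← hfac]
  rw [← hind.integral_fun_prod_comp (f := fun j x =>
    Complex.exp ((-1) ^ (n - 1 - j.val) * s * Real.log x)) (fun j => hm j)
    fun j => Measurable.aestronglyMeasurable (by fun_prop)]
  congr 1 with ω
  rw [← Complex.exp_sum, Finset.sum_apply, Finset.sum_range, Complex.ofReal_sum, Finset.mul_sum]
  congr 1
  refine Finset.sum_congr rfl fun j _ => ?_
  push_cast
  ring

end Law

/-! ### The Meijer integrands as `-φ(s)/s` -/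

/-- The binding poles are `-1`, from `Γ(1+s)`, and `0`, from the single factor `Γ(-s)`; the factors
`Γ(1-s)` have poles only from `1` on. -/
theorem meijerSeparates_oneZeros_allOnes {p q : ℕ} (hp : 1 ≤ p) (hq : 1 ≤ q) (c : ℝ) :
    MeijerSeparates q p (oneZeros p) (allOnes q) c ↔ -1 < c ∧ c < 0 := by
  constructor
  · rintro ⟨h1, h2⟩
    refine ⟨by simpa [allOnes] using h1 ⟨0, hq⟩ hq 0, by simpa [oneZeros] using h2 ⟨0, hp⟩ hp 0⟩
  · rintro ⟨h1, h2⟩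
    refine ⟨fun j _ l => ?_, fun k _ l => ?_⟩
    · simp [allOnes]
      linarith [Nat.cast_nonneg (α := ℝ) l]
    · have := Nat.cast_nonneg (α := ℝ) l
      unfold oneZeros
      split_ifs <;> simp <;> linarith

theorem meijerSeparates_one_one (c : ℝ) :
    MeijerSeparates 1 1 ![(1 : ℂ)] ![(1 : ℂ), 0] c ↔ -1 < c ∧ c < 0 := by
  constructor
  · rintro ⟨h1, h2⟩
    exact ⟨by simpa using h1 0 (by simp) 0, by simpa using h2 0 (by simp) 0⟩
  · rintro ⟨h1, h2⟩
    refine ⟨fun j hj l => ?_, fun k _ l => ?_⟩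
    · obtain rfl : j = 0 := by ext; simpa using hj
      simp
      linarith [Nat.cast_nonneg (α := ℝ) l]
    · obtain rfl : k = 0 := Subsingleton.elim _ _
      simp
      linarith [Nat.cast_nonneg (α := ℝ) l]

theorem Gamma_neg_eq {s : ℂ} (hs : s ≠ 0) :
    Complex.Gamma (-s) = -(Complex.Gamma (1 - s) / s) := by
  have h := Complex.Gamma_add_one (-s) (neg_ne_zero.2 hs)
  rw [neg_add_eq_sub] at h
  rw [h]
  field_simp

/-- Every parameter lies in the numerator, so both denominator products are empty. -/
theorem meijerIntegrand_oneZeros_allOnes {p q : ℕ} (hp : 1 ≤ p) (z : ℂ) {s : ℂ} (hs : s ≠ 0) :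
    meijerIntegrand q p (oneZeros p) (allOnes q) z s = z ^ (-s) * (-gammaProd q p s / s) := by
  obtain ⟨k, rfl⟩ := Nat.exists_eq_add_of_le' hp
  have e1 : ∏ i : Fin (k + 1), Complex.Gamma (1 - oneZeros (k + 1) i - s) =
      -(Complex.Gamma (1 - s) ^ (k + 1) / s) := by
    rw [Fin.prod_univ_succ]
    simp [oneZeros, Gamma_neg_eq hs]
    ring
  have h1 : Finset.univ.filter (fun i : Fin (k + 1) => k + 1 ≤ i.val) = ∅ := by
    ext i; simp; omega
  have h2 : Finset.univ.filter (fun i : Fin q => q ≤ i.val) = ∅ := by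
    ext i; simp
  have h3 : Finset.univ.filter (fun i : Fin (k + 1) => i.val < k + 1) = Finset.univ := by
    ext i; simp; omega
  have h4 : Finset.univ.filter (fun i : Fin q => i.val < q) = Finset.univ := by
    ext i; simp
  rw [meijerIntegrand, h1, h2, h3, h4, e1, gammaProd, Finset.prod_empty,
    Finset.prod_empty]
  simp only [allOnes, Finset.prod_const, Finset.card_univ, Fintype.card_fin, mul_one, div_one]
  ring

/-- The lower parameter `0` puts `Γ(1-s)` in the denominator; it is nonzero here and cancels against
`Γ(-s) = -Γ(1-s)/s`. -/
theorem meijerIntegrand_one_one (z : ℂ) {s : ℂ} (h1 : s.re < 0) :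
    meijerIntegrand 1 1 ![(1 : ℂ)] ![(1 : ℂ), 0] z s = z ^ (-s) * (-gammaProd 1 0 s / s) := by
  have hs : s ≠ 0 := fun h => by simp [h] at h1
  have hG : Complex.Gamma (1 - s) ≠ 0 := Complex.Gamma_ne_zero_of_re_pos (by simp; linarith)
  rw [meijerIntegrand, show Finset.univ.filter (fun j : Fin 2 => 1 ≤ j.val) = {1} by decide,
    show Finset.univ.filter (fun j : Fin 2 => j.val < 1) = {0} by decide,
    show Finset.univ.filter (fun j : Fin 1 => 1 ≤ j.val) = ∅ by decide,
    show Finset.univ.filter (fun j : Fin 1 => j.val < 1) = {0} by decide]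
  simp [Gamma_neg_eq hs, gammaProd]
  field_simp

/-- A Mellin-Barnes integral that is separated exactly by the lines of a nonempty strip and has a
common value along them is the value of the Meijer function. -/
theorem meijerGWellDefined_and_eq {m n p q : ℕ} {a : Fin p → ℂ} {b : Fin q → ℂ} {z v : ℂ}
    (hsep : ∃ c, MeijerSeparates m n a b c)
    (h : ∀ c, MeijerSeparates m n a b c →
      Integrable (fun t : ℝ => meijerIntegrand m n a b z (linePoint c t)) ∧
        meijerLineIntegral m n a b z c = v) :
    MeijerGWellDefined m n a b z ∧ v = meijerG m n a b z := by
  have hv : meijerG m n a b z = v := by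
    rw [meijerG, dif_pos hsep]
    exact (h _ hsep.choose_spec).2
  exact ⟨⟨hsep, fun c hc => ⟨(h c hc).1, (h c hc).2.trans hv.symm⟩⟩, hv.symm⟩

/-! ### Both inversion formulas from the transform alone -/

section Transform

variable {μ : Measure ℝ} {a b : ℕ}

theorem integrable_exp_mul_of_transform
    (hφ : ∀ s : ℂ, -1 < s.re → s.re < 1 → ∫ y : ℝ, Complex.exp (s * y) ∂μ = gammaProd a b s)
    {σ : ℝ} (h1 : -1 < σ) (h2 : σ < 1) : Integrable (fun y => Real.exp (σ * y)) μ := by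
  -- A Bochner integral of a non-integrable function is `0`, so a nonzero value, here a product of
  -- Gamma values, forces integrability.
  have hne : ∫ y : ℝ, Complex.exp (σ * y) ∂μ ≠ 0 := by
    rw [hφ σ (by simpa) (by simpa), gammaProd]
    exact mul_ne_zero (pow_ne_zero _ (Complex.Gamma_ne_zero_of_re_pos (by simp; linarith)))
      (pow_ne_zero _ (Complex.Gamma_ne_zero_of_re_pos (by simp; linarith)))
  refine (Integrable.of_integral_ne_zero hne).norm.congr (ae_of_all _ fun y => ?_)
  simp [Complex.norm_exp]

theorem integrable_id_of_transform
    (hφ : ∀ s : ℂ, -1 < s.re → s.re < 1 → ∫ y : ℝ, Complex.exp (s * y) ∂μ = gammaProd a b s) :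
    Integrable (fun y => y) μ := by
  refine integrable_of_mem_interior_integrableExpSet (X := fun y => y) ?_
  refine mem_interior.2 ⟨Ioo (-1) 1, fun t ht => ?_, isOpen_Ioo, by simp⟩
  exact integrable_exp_mul_of_transform hφ ht.1 ht.2

/-- No contour shift is needed: inversion on each line of the strip yields the same cdf, which makes
the line integral independent of the line. -/
theorem meijerG_eq_cdf [IsProbabilityMeasure μ] [NullSingletonClass μ] (ha : 1 ≤ a)
    (hφ : ∀ s : ℂ, -1 < s.re → s.re < 1 → ∫ y : ℝ, Complex.exp (s * y) ∂μ = gammaProd a b s)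
    {m n p q : ℕ} {α : Fin p → ℂ} {β : Fin q → ℂ} (z : ℝ)
    (hsep : ∀ c, MeijerSeparates m n α β c ↔ -1 < c ∧ c < 0)
    (hint : ∀ s : ℂ, s.re < 0 → meijerIntegrand m n α β (Real.exp z : ℂ) s =
      (Real.exp z : ℂ) ^ (-s) * (-gammaProd a b s / s)) :
    MeijerGWellDefined m n α β (Real.exp z : ℂ) ∧
      ((cdf μ z : ℝ) : ℂ) = meijerG m n α β (Real.exp z : ℂ) := by
  refine meijerGWellDefined_and_eq ⟨-1 / 2, (hsep _).2 (by norm_num)⟩ fun c hc => ?_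
  obtain ⟨h1, h2⟩ := (hsep c).1 hc
  have hline (t : ℝ) : meijerIntegrand m n α β (Real.exp z : ℂ) (linePoint c t) =
      (Real.exp z : ℂ) ^ (-(c + t * Complex.I)) *
        (-gammaProd a b (c + t * Complex.I) / (c + t * Complex.I)) :=
    hint _ (by simpa [linePoint])
  have hφc (t : ℝ) : ∫ y : ℝ, Complex.exp ((c + t * Complex.I) * y) ∂μ =
      gammaProd a b (c + t * Complex.I) := hφ _ (by simpa) (by simp; linarith)
  have hI := integrable_gammaProd_div ha b h1 h2
  constructor
  · simp_rw [hline, neg_div, mul_neg]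
    refine (hI.bdd_mul (c := Real.exp z ^ (-c)) (Continuous.aestronglyMeasurable ?_)
      (ae_of_all _ fun t => ?_)).neg
    · exact Continuous.const_cpow (by fun_prop) (Or.inl (by simp))
    · rw [Complex.norm_cpow_eq_rpow_re_of_pos (Real.exp_pos z)]
      simp
  · rw [cdf_eq_line_integral μ h2 (integrable_exp_mul_of_transform hφ h1 (by linarith))
      (by simpa only [hφc] using hI) z]
    simp_rw [hφc]
    rw [meijerLineIntegral, integral_mul_const]
    simp_rw [hline]
    field_simp

theorem integral_sin_eq_im (w z : ℝ) (μ : Measure ℝ) [IsProbabilityMeasure μ] :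
    ∫ y, Real.sin (w * (y - z)) ∂μ =
      (Complex.exp (-(w * z * Complex.I)) * ∫ y : ℝ, Complex.exp (w * Complex.I * y) ∂μ).im := by
  have hint : Integrable (fun y : ℝ =>
      Complex.exp (-(w * z * Complex.I)) * Complex.exp (w * Complex.I * y)) μ := by
    refine Integrable.of_bound (Continuous.aestronglyMeasurable (by fun_prop)) 1
      (ae_of_all _ fun y => ?_)
    simp [Complex.norm_exp]
  rw [← integral_const_mul, ← RCLike.im_eq_complex_im, ← integral_im hint]
  congr 1 with y
  rw [← Complex.exp_add, RCLike.im_eq_complex_im,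
    show -(w * z * Complex.I) + w * Complex.I * y = ((w * (y - z) : ℝ) : ℂ) * Complex.I by
      push_cast; ring, Complex.exp_ofReal_mul_I_im]

theorem gilPelaez_of_transform [IsProbabilityMeasure μ] [NullSingletonClass μ] (ha : 1 ≤ a)
    (hφ : ∀ s : ℂ, -1 < s.re → s.re < 1 → ∫ y : ℝ, Complex.exp (s * y) ∂μ = gammaProd a b s)
    (z : ℝ) {g : ℝ → ℝ} (hg : ∀ w, 0 < w →
      g w = -(Complex.exp (-(w * z * Complex.I)) * gammaProd a b (w * Complex.I)).im /
        (Real.pi * w)) :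
    IntegrableOn g (Ioi 0) ∧ cdf μ z = 1 / 2 + ∫ w in Ioi (0 : ℝ), g w := by
  have hid := integrable_id_of_transform hφ
  set h : ℝ → ℝ := fun w => (∫ y, Real.sin (w * (y - z)) ∂μ) / w
  have him (w : ℝ) : ∫ y, Real.sin (w * (y - z)) ∂μ =
      (Complex.exp (-(w * z * Complex.I)) * gammaProd a b (w * Complex.I)).im := by
    rw [integral_sin_eq_im, hφ _ (by simp) (by simp)]
  have hmeas : AEStronglyMeasurable h volume := by
    have : StronglyMeasurable fun w => ∫ y, Real.sin (w * (y - z)) ∂μ :=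
      StronglyMeasurable.integral_prod_right (f := fun w y : ℝ => Real.sin (w * (y - z)))
        (Continuous.stronglyMeasurable (by unfold Function.uncurry; fun_prop))
    exact (this.measurable.div measurable_id).aestronglyMeasurable
  obtain ⟨C, hC, hb⟩ := exists_norm_gammaProd_mul_I_le ha b
  have hint : IntegrableOn h (Ioi 0) := by
    -- Near `0` the first moment bounds the integrand; beyond `1` the decay of `φ(iw)` gives `C /
    -- w²`.
    rw [← Ioc_union_Ioi_eq_Ioi zero_le_one]
    refine IntegrableOn.union ?_ ?_
    · refine IntegrableOn.of_bound (by simp) hmeas.restrict (∫ y, |y - z| ∂μ) ?_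
      filter_upwards [ae_restrict_mem measurableSet_Ioc] with w hw
      rw [norm_div, Real.norm_of_nonneg hw.1.le, div_le_iff₀ hw.1, ← integral_mul_const]
      refine norm_integral_le_of_norm_le ((hid.sub (integrable_const z)).abs.mul_const w)
        (ae_of_all _ fun y => ?_)
      calc _ ≤ |w * (y - z)| := Real.abs_sin_le_abs
        _ = _ := by rw [abs_mul, abs_of_pos hw.1, mul_comm]
    · refine ((integrableOn_Ioi_rpow_of_lt (a := -2) (by norm_num) one_pos).const_mul C).mono'
        hmeas.restrict ?_
      filter_upwards [ae_restrict_mem measurableSet_Ioi] with w (hw : 1 < w)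
      have hw0 : 0 < w := by linarith
      rw [norm_div, Real.norm_of_nonneg hw0.le, him]
      calc _ ≤ C / w / w := by
            gcongr
            refine (Complex.abs_im_le_norm _).trans ?_
            rw [norm_mul]
            refine (mul_le_of_le_one_left (norm_nonneg _) ?_).trans (hb w hw0)
            simp [Complex.norm_exp]
        _ = _ := by
            rw [Real.rpow_neg hw0.le, Real.rpow_two]
            field_simp
  have hgh : ∀ w ∈ Ioi (0 : ℝ), -(1 / Real.pi) * h w = g w := fun w hw => by
    rw [hg w hw, ← him]
    have : (0 : ℝ) < w := hw
    simp only [h]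
    field_simp
  constructor
  · exact IntegrableOn.congr_fun (hint.const_mul _) hgh measurableSet_Ioi
  · rw [cdf_eq_half_sub_integral μ hid z hint, ← setIntegral_congr_fun measurableSet_Ioi hgh,
      integral_const_mul]
    ring

end Transform

/-! ### The explicit kernels and the final assembly -/

theorem oddKernel_eq_im (n : ℕ) (z w : ℝ) {t : ℝ} (ht : 0 < t) :
    oddKernel n z w t = -(Complex.exp (-(w * z * Complex.I)) *
      (Complex.exp (-t) * (t : ℂ) ^ (1 + w * Complex.I - 1))).im *
        ((Real.pi * w / Real.sinh (Real.pi * w)) ^ ((n - 1) / 2) / (Real.pi * w)) := by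
  have : Complex.exp (-(w * z * Complex.I)) *
      (Complex.exp (-t) * (t : ℂ) ^ (1 + w * Complex.I - 1)) =
      (Real.exp (-t) : ℂ) * Complex.exp (((Real.log t - z) * w : ℝ) * Complex.I) := by
    rw [add_sub_cancel_left, Complex.cpow_def_of_ne_zero (by simpa using ht.ne'),
      ← Complex.ofReal_log ht.le, mul_left_comm, ← Complex.exp_add]
    push_cast
    congr 2
    ring
  rw [this, Complex.im_ofReal_mul, Complex.exp_ofReal_mul_I_im, oddKernel, ← mul_neg,
    ← Real.sin_neg, ← neg_mul, neg_sub]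
  ring

/-- The `t`-integral is the imaginary part of Euler's integral for the unpaired `Γ(1+iw)`; all other
factors are constant in `t`. -/
theorem integrableOn_and_integral_oddKernel (n : ℕ) (z w : ℝ) :
    IntegrableOn (fun t => oddKernel n z w t) (Ioi 0) ∧
      ∫ t in Ioi (0 : ℝ), oddKernel n z w t =
        -(Complex.exp (-(w * z * Complex.I)) * Complex.Gamma (1 + w * Complex.I)).im *
          ((Real.pi * w / Real.sinh (Real.pi * w)) ^ ((n - 1) / 2) / (Real.pi * w)) := by
  have hint := (Complex.GammaIntegral_convergent (s := 1 + w * Complex.I) (by simp)).const_mul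
    (Complex.exp (-(w * z * Complex.I)))
  constructor
  · refine IntegrableOn.congr_fun (hint.im.neg.mul_const
      ((Real.pi * w / Real.sinh (Real.pi * w)) ^ ((n - 1) / 2) / (Real.pi * w)))
      (fun t ht => ?_) measurableSet_Ioi
    rw [oddKernel_eq_im n z w ht]
    simp
  · rw [setIntegral_congr_fun measurableSet_Ioi fun t ht => oddKernel_eq_im n z w ht,
      integral_mul_const, integral_neg, Complex.Gamma_eq_integral (by simp), Complex.GammaIntegral,
      ← integral_const_mul]
    simp_rw [← RCLike.im_eq_complex_im]
    rw [← integral_im]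
    · simp
    · simpa using hint

theorem proposition5 {Ω : Type*} [MeasurableSpace Ω] (P : Measure Ω) [IsProbabilityMeasure P]
    (X : ℕ → Ω → ℝ)
    (hlaw : ∀ i : ℕ, 1 ≤ i → HasLaw (X i) (expMeasure 1) P)
    (hindep : iIndepFun (fun i : ℕ => X (i + 1)) P)
    (n : ℕ) (hn : 1 ≤ n) :
    -- `Z_n = ln Y_n` is an alternating sum of the `ln X_i`, the sign of `ln X_n` being `+`
    (∀ᵐ ω ∂P, logRatioZ X n ω = ∑ i ∈ Finset.Icc 1 n, (-1 : ℝ) ^ (n - i) * Real.log (X i ω)) ∧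
    ∀ z : ℝ,
      -- (i)
      (n = 1 →
        MeijerGWellDefined 1 1 ![(1 : ℂ)] ![(1 : ℂ), 0] (Real.exp z : ℂ) ∧
        ((cdf (P.map (logRatioZ X n)) z : ℝ) : ℂ) =
          meijerG 1 1 ![(1 : ℂ)] ![(1 : ℂ), 0] (Real.exp z : ℂ)) ∧
      (Odd n → 3 ≤ n →
        MeijerGWellDefined ((n + 1) / 2) ((n - 1) / 2)
          (oneZeros ((n - 1) / 2)) (allOnes ((n + 1) / 2)) (Real.exp z : ℂ) ∧
        ((cdf (P.map (logRatioZ X n)) z : ℝ) : ℂ) =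
          meijerG ((n + 1) / 2) ((n - 1) / 2)
            (oneZeros ((n - 1) / 2)) (allOnes ((n + 1) / 2)) (Real.exp z : ℂ)) ∧
      (Even n →
        MeijerGWellDefined (n / 2) (n / 2)
          (oneZeros (n / 2)) (allOnes (n / 2)) (Real.exp z : ℂ) ∧
        ((cdf (P.map (logRatioZ X n)) z : ℝ) : ℂ) =
          meijerG (n / 2) (n / 2) (oneZeros (n / 2)) (allOnes (n / 2)) (Real.exp z : ℂ)) ∧
      -- (ii)
      (Odd n →
        (∀ w ∈ Ioi (0 : ℝ), IntegrableOn (fun t => oddKernel n z w t) (Ioi 0)) ∧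
        IntegrableOn (fun w => ∫ t in Ioi (0 : ℝ), oddKernel n z w t) (Ioi 0) ∧
        cdf (P.map (logRatioZ X n)) z =
          1 / 2 + ∫ w in Ioi (0 : ℝ), ∫ t in Ioi (0 : ℝ), oddKernel n z w t) ∧
      (Even n →
        IntegrableOn (fun w => evenKernel n z w) (Ioi 0) ∧
        cdf (P.map (logRatioZ X n)) z =
          1 / 2 + ∫ w in Ioi (0 : ℝ), evenKernel n z w) := by
  have hmeas : AEMeasurable (logRatioZ X n) P := by
    refine AEMeasurable.congr ?_ (logRatioZ_ae_eq_sum_range hlaw n).symm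
    exact Finset.aemeasurable_sum _ fun j _ =>
      (Real.measurable_log.comp_aemeasurable (hlaw (j + 1) (by omega)).aemeasurable).const_mul _
  have : IsProbabilityMeasure (P.map (logRatioZ X n)) := Measure.isProbabilityMeasure_map hmeas
  have := nullSingletonClass_map_logRatioZ hlaw hindep hn
  have hφ (s : ℂ) (h1 : -1 < s.re) (h2 : s.re < 1) :=
    integral_cexp_map_logRatioZ hlaw hindep n h1 h2
  have ha : 1 ≤ (n + 1) / 2 := by omega
  have hne {s : ℂ} (hs : s.re < 0) : s ≠ 0 := fun h => by simp [h] at hs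
  refine ⟨logRatioZ_ae_eq_sum hlaw n, fun z => ⟨?_, ?_, ?_, ?_, ?_⟩⟩
  · rintro rfl
    exact meijerG_eq_cdf ha hφ z meijerSeparates_one_one fun s hs => meijerIntegrand_one_one _ hs
  · rintro hodd h3
    have hp : (n - 1) / 2 = n / 2 := by
      have := Nat.odd_iff.1 hodd
      omega
    rw [hp]
    exact meijerG_eq_cdf ha hφ z (meijerSeparates_oneZeros_allOnes (by omega) ha)
      fun s hs => meijerIntegrand_oneZeros_allOnes (by omega) _ (hne hs)
  · intro heven
    have hq : (n + 1) / 2 = n / 2 := by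
      have := Nat.even_iff.1 heven
      omega
    rw [hq] at hφ ha
    exact meijerG_eq_cdf ha hφ z (meijerSeparates_oneZeros_allOnes ha ha)
      fun s hs => meijerIntegrand_oneZeros_allOnes ha _ (hne hs)
  · intro hodd
    refine ⟨fun w _ => (integrableOn_and_integral_oddKernel n z w).1,
      gilPelaez_of_transform ha hφ z fun w hw => ?_⟩
    obtain ⟨k, rfl⟩ := hodd
    -- Splitting off one `Γ(1+iw)` leaves `k` reflected pairs, whose product is real and leaves the
    -- imaginary part.
    rw [(integrableOn_and_integral_oddKernel _ z w).2, gammaProd,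
      show (2 * k + 1 + 1) / 2 = k + 1 by omega, show (2 * k + 1) / 2 = k by omega,
      show (2 * k + 1 - 1) / 2 = k by omega, pow_succ', mul_assoc (Complex.Gamma _), ← mul_pow,
      Gamma_one_add_mul_Gamma_one_sub_mul_I hw.ne', ← mul_assoc, ← Complex.ofReal_pow,
      Complex.im_mul_ofReal]
    ring
  · intro heven
    refine gilPelaez_of_transform ha hφ z fun w hw => ?_
    obtain ⟨k, rfl⟩ := heven
    have him : (Complex.exp (-(w * z * Complex.I))).im = -Real.sin (z * w) := by
      rw [show -((w : ℂ) * z * Complex.I) = ((-(z * w) : ℝ) : ℂ) * Complex.I by push_cast; ring,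
        Complex.exp_ofReal_mul_I_im, Real.sin_neg]
    rw [evenKernel, gammaProd, show (k + k + 1) / 2 = k by omega, show (k + k) / 2 = k by omega,
      ← mul_pow, Gamma_one_add_mul_Gamma_one_sub_mul_I hw.ne', ← Complex.ofReal_pow,
      Complex.im_mul_ofReal, him]
    ring
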